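/- All graphs are finite, simple and undirected. A bipartite graph $G$ with bipartition $(X,Y)$ of its vertex set is a \emph{chain graph} if the vertices of $X$ can be ordered $x_1,\dots,x_m$ so that $N(x_1)\subseteq N(x_2)\subseteq\dots\subseteq N(x_m)$. A \emph{path cover} of $G$ is a spanning subgraph every component of which is a path (single vertices allowed); it is \emph{optimal} if it has the maximum number of edges among all path covers of $G$. A vertex of a graph is \emph{internal} if its degree is at least $2$ and \emph{pendant} if its degree is $1$. For a connected graph $G$, $\mathrm{Opt}(G)$ denotes the maximum number of internal vertices of a spanning tree of $G$. Let $G$ be a connected chain graph with at least two vertices and let $P^*$ be an optimal path cover of $G$. Then $\mathrm{Opt}(G)=|E(P^*)|-1$ or $\mathrm{Opt}(G)=|E(P^*)|-2$. Both values occur, even among connected chain graphs in which every vertex is adjacent to at most one pendant vertex: there is such a graph $G_1$ with parts of sizes $5$ and $5$, an optimal path cover of which has $8$ edges, with $\mathrm{Opt}(G_1)=6=8-2$, and there is such a graph $G_2$ with parts of sizes $6$ and $5$, an optimal path cover of which has $9$ edges, with $\mathrm{Opt}(G_2)=8=9-1$. -/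

import Mathlib

namespace ChainMIST

open SimpleGraph

variable {V : Type*}

/-- `G = (X, Y, E)` is a chain graph with bipartition `(X, Y)`: the vertices of `X` can be
linearly ordered `x 0, x 1, …` so that `N(x 0) ⊆ N(x 1) ⊆ …`. -/
structure IsChainGraphWith (G : SimpleGraph V) (X Y : Set V) : Prop where
  isBipartiteWith : G.IsBipartiteWith X Y
  union_eq : X ∪ Y = Set.univ
  chain : ∃ (m : ℕ) (x : Fin m → V), Function.Injective x ∧ Set.range x = X ∧
    Monotone fun i => G.neighborSet (x i)

/-- A chain graph (connectedness is not part of the definition). -/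
def IsChainGraph (G : SimpleGraph V) : Prop :=
  ∃ X Y : Set V, IsChainGraphWith G X Y

/-- A path cover of `G`: a spanning subgraph `P` of `G` every component of which is a path
(possibly a path on a single vertex). A spanning subgraph is a graph on the same vertex type all
of whose edges are edges of `G`. -/
def IsPathCover (G P : SimpleGraph V) : Prop :=
  P ≤ G ∧ ∀ c : P.ConnectedComponent, ∃ n : ℕ, Nonempty (c.toSimpleGraph ≃g pathGraph n)

/-- The number of edges. -/
noncomputable def numEdges (P : SimpleGraph V) : ℕ := P.edgeSet.ncard

/-- An optimal path cover: a path cover with the maximum number of edges. -/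
def IsOptimalPathCover (G P : SimpleGraph V) : Prop :=
  IsPathCover G P ∧ ∀ Q : SimpleGraph V, IsPathCover G Q → numEdges Q ≤ numEdges P

/-- A spanning tree of `G`. -/
def IsSpanningTree (G T : SimpleGraph V) : Prop :=
  T ≤ G ∧ T.IsTree

/-- The set of internal vertices, i.e. those of degree at least two. -/
def internalVertices (T : SimpleGraph V) : Set V :=
  {v | 2 ≤ (T.neighborSet v).ncard}

/-- The number of internal vertices. -/
noncomputable def numInternal (T : SimpleGraph V) : ℕ := (internalVertices T).ncard

/-- A maximum internal spanning tree of `G`. -/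
def IsMIST (G T : SimpleGraph V) : Prop :=
  IsSpanningTree G T ∧ ∀ T' : SimpleGraph V, IsSpanningTree G T' → numInternal T' ≤ numInternal T

/-- `Opt G`: the maximum number of internal vertices of a spanning tree of `G`. -/
noncomputable def Opt (G : SimpleGraph V) : ℕ :=
  sSup {k | ∃ T : SimpleGraph V, IsSpanningTree G T ∧ numInternal T = k}

/-- `Opt G` is the number of internal vertices of any maximum internal spanning tree. -/
theorem IsMIST.numInternal_eq_opt {G T : SimpleGraph V} (h : IsMIST G T) :
    numInternal T = Opt G := by
  have hg : IsGreatest {k | ∃ T : SimpleGraph V, IsSpanningTree G T ∧ numInternal T = k}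
      (numInternal T) := by
    refine ⟨⟨T, h.1, rfl⟩, ?_⟩
    rintro k ⟨T', hT', rfl⟩
    exact h.2 T' hT'
  exact hg.csSup_eq.symm

/-- A finite connected graph has a maximum internal spanning tree. -/
theorem exists_isMIST [Finite V] {G : SimpleGraph V} (hG : G.Connected) :
    ∃ T : SimpleGraph V, IsMIST G T := by
  obtain ⟨T₀, hle, hT₀⟩ := hG.exists_isTree_le
  obtain ⟨T, hT, hmax⟩ := Set.exists_max_image {T | IsSpanningTree G T} numInternal
    (Set.toFinite _) ⟨T₀, hle, hT₀⟩
  exact ⟨T, hT, hmax⟩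

/-- A pendant vertex, i.e. a vertex of degree one. -/
def IsPendant (G : SimpleGraph V) (v : V) : Prop := (G.neighborSet v).ncard = 1

/-- Every vertex has at most one pendant neighbor. -/
def AtMostOnePendantNeighbor (G : SimpleGraph V) : Prop :=
  ∀ u a b : V, G.Adj u a → G.Adj u b → IsPendant G a → IsPendant G b → a = b

end ChainMIST

namespace ChainMIST

open SimpleGraph

variable {V : Type*}

/-! Let `n` be the number of vertices and call `∑ (2 - deg)`, truncated at zero, the deficiency.
Upper bound: in a spanning tree with `L` leaves the total degree excess over two is `L - 2`.
Deleting one edge per unit of excess leaves a path cover with at least `(n - 1) - (L - 2)` edges,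
one more than the number of internal vertices. Lower bound: a connected chain graph has an edge `xy`
such that every vertex is adjacent to `x` or `y`. A path cover has deficiency plus edge count `2n -
|E|`. If `x` and `y` lie on one path, each other component can be hung from an end onto `x` or `y`,
which adds one edge and lowers the deficiency by at least one. The resulting tree has `n - 1` edges
and deficiency equal to its number of leaves, so at least `|E| - 1` vertices are internal. If `x`
and `y` lie on different paths, adding `xy` first costs at most one more
(`numEdges_le_opt_add_two`). -/

/-! ### Path covers: numberings, and forests of maximum degree two. -/

/-- A numbering of the vertices that is injective on components and in which adjacent vertices
are consecutive. -/
def IsPathNumbering (P : SimpleGraph V) (r : V → ℕ) : Prop :=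
  (∀ u v, P.Adj u v → r v = r u + 1 ∨ r u = r v + 1) ∧
    ∀ u v, P.Reachable u v → r u = r v → u = v

theorem IsPathCover.exists_isPathNumbering {G P : SimpleGraph V} (h : IsPathCover G P) :
    ∃ r : V → ℕ, IsPathNumbering P r := by
  choose n e using h.2
  have e' := fun c => (e c).some
  -- The isomorphisms depend on the component, so equal components must be substituted before values
  -- can be compared.
  have transport : ∀ v c (hv : v ∈ c.supp), c = P.connectedComponentMk v →
      (e' c ⟨v, hv⟩ : ℕ) = e' (P.connectedComponentMk v) ⟨v, rfl⟩ := by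
    rintro v c hv rfl
    rfl
  refine ⟨fun v => (e' (P.connectedComponentMk v) ⟨v, rfl⟩ : ℕ), ?_, ?_⟩
  · intro u v huv
    have key : ∀ c (hu : u ∈ c.supp) (hv : v ∈ c.supp),
        (e' c ⟨v, hv⟩ : ℕ) = e' c ⟨u, hu⟩ + 1 ∨ (e' c ⟨u, hu⟩ : ℕ) = e' c ⟨v, hv⟩ + 1 := by
      intro c hu hv
      have : (pathGraph (n c)).Adj (e' c ⟨u, hu⟩) (e' c ⟨v, hv⟩) :=
        (e' c).map_adj_iff.2 huv
      rw [pathGraph_adj] at this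
      omega
    have hc := ConnectedComponent.eq.2 huv.reachable
    have := key _ rfl hc.symm
    rwa [transport v _ hc.symm hc] at this
  · intro u v huv heq
    have hc := ConnectedComponent.eq.2 huv
    dsimp only at heq
    rw [← transport v _ hc.symm hc] at heq
    have := (e' _).injective (Fin.ext heq)
    exact congrArg Subtype.val this

/-- Every edge is a bridge: once `uv` with `r v = r u + 1` is removed, a walk from `u` never climbs
above `r u`, because within the component only `u` has that number and only `v` the next one. -/
theorem IsPathNumbering.isAcyclic {P : SimpleGraph V} {r : V → ℕ} (h : IsPathNumbering P r) :
    P.IsAcyclic := by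
  rw [isAcyclic_iff_forall_adj_isBridge]
  have key : ∀ u v, P.Adj u v → r v = r u + 1 → P.IsBridge s(u, v) := by
    intro u v huv hr
    rw [isBridge_iff]
    intro hreach
    have : ∀ a b, (P \ fromEdgeSet {s(u, v)}).Walk a b → P.Reachable u a → r a ≤ r u →
        r b ≤ r u := by
      intro a b w
      induction w with
      | nil => exact fun _ h => h
      | @cons a c d hac w ih =>
        intro hua ha
        rw [sdiff_adj] at hac
        have huc := hua.trans hac.1.reachable
        refine ih huc ?_
        by_contra hlt
        have h1 := h.1 a c hac.1
        have h2 : u = a := h.2 u a hua (by omega)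
        have h3 : c = v := by
          refine h.2 c v (huc.symm.trans huv.reachable) ?_
          subst h2
          omega
        subst h2 h3
        exact hac.2 (by simpa using hac.1.ne)
    obtain ⟨w⟩ := hreach
    have := this u v w (Reachable.refl u) le_rfl
    omega
  intro u v huv
  rcases h.1 u v huv with h1 | h1
  · exact key u v huv h1
  · rw [Sym2.eq_swap]
    exact key v u huv.symm h1

theorem IsPathNumbering.ncard_neighborSet_le {P : SimpleGraph V} {r : V → ℕ}
    (h : IsPathNumbering P r) (v : V) : (P.neighborSet v).ncard ≤ 2 := by
  calc (P.neighborSet v).ncard ≤ ({r v + 1, r v - 1} : Set ℕ).ncard := by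
        refine Set.ncard_le_ncard_of_injOn r ?_ ?_ (Set.toFinite _)
        · intro w hw
          have := h.1 v w hw
          simp only [Set.mem_insert_iff, Set.mem_singleton_iff]
          omega
        · intro a ha b hb hab
          exact h.2 a b (((P.mem_neighborSet v a).1 ha).symm.reachable.trans
            ((P.mem_neighborSet v b).1 hb).reachable) hab
    _ ≤ 2 := Set.ncard_insert_le _ _ |>.trans (by simp)

/-- A longest path is the whole tree. Its ends have no neighbor off the path by maximality, and an
inner vertex already has its two neighbors on it; connectedness does the rest. -/
theorem exists_iso_pathGraph_of_isTree [Finite V] {T : SimpleGraph V} (hT : T.IsTree)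
    (hdeg : ∀ v, (T.neighborSet v).ncard ≤ 2) : ∃ n : ℕ, Nonempty (T ≃g pathGraph n) := by
  classical
  have := hT.connected.nonempty
  obtain ⟨u, v, p, hp, hmax⟩ := Walk.exists_isPath_forall_isPath_length_le_length T
  have step : ∀ a b, a ∈ p.support → T.Adj a b → p.toSubgraph.Adj a b := by
    intro a b ha hab
    obtain ⟨i, rfl, hi⟩ := Walk.mem_support_iff_exists_getVert.1 ha
    have adj_succ : ∀ j, j < p.length → p.toSubgraph.Adj (p.getVert j) (p.getVert (j + 1)) :=
      fun j hj => p.toSubgraph_adj_getVert hj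
    rcases Nat.eq_zero_or_pos i with rfl | hpos
    · rw [Walk.getVert_zero] at hab ⊢
      have hb : b ∈ p.support := by
        by_contra hb
        have := hmax _ _ _ (hp.cons (h := hab.symm) hb)
        simp at this
      have hne : p.length ≠ 0 := by
        intro h0
        have hnil := Walk.length_eq_zero_iff.1 h0
        rw [Walk.nil_iff_support_eq.1 hnil, List.mem_singleton] at hb
        exact hab.ne hb.symm
      rw [hT.isAcyclic.eq_snd_of_adj_start hp hab hb]
      simpa using adj_succ 0 (by omega)
    rcases hi.eq_or_lt with rfl | hlt
    · rw [Walk.getVert_length] at hab ⊢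
      have hb : b ∈ p.support := by
        by_contra hb
        have := hmax _ _ _ (hp.concat hb hab)
        simp at this
      rw [hT.isAcyclic.eq_penultimate_of_adj_end hp hab hb]
      have := adj_succ (p.length - 1) (by omega)
      rw [Nat.sub_add_cancel hpos, Walk.getVert_length] at this
      exact this.symm
    · have h1 := adj_succ i hlt
      have h2 := (adj_succ (i - 1) (by omega)).symm
      rw [Nat.sub_add_cancel hpos] at h2
      have hne : p.getVert (i - 1) ≠ p.getVert (i + 1) := by
        intro h
        have := hp.getVert_injOn (by simp; omega) (by simp; omega) h
        omega
      have hsub : ({p.getVert (i - 1), p.getVert (i + 1)} : Set V) ⊆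
          T.neighborSet (p.getVert i) := by
        rintro w (rfl | rfl)
        · exact h2.adj_sub
        · exact h1.adj_sub
      have heq := Set.eq_of_subset_of_ncard_le hsub
        (by rw [Set.ncard_pair hne]; exact hdeg _) (Set.toFinite _)
      have hb : b ∈ T.neighborSet (p.getVert i) := hab
      rw [← heq] at hb
      rcases hb with rfl | rfl
      · exact h2
      · exact h1
  have hsupp : ∀ w, w ∈ p.support := by
    intro w
    have : ∀ a b, T.Walk a b → a ∈ p.support → b ∈ p.support := by
      intro a b q
      induction q with
      | nil => exact id
      | cons h q ih =>
        exact fun ha => ih ((p.mem_verts_toSubgraph).1 (step _ _ ha h).snd_mem)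
    obtain ⟨q⟩ := hT.connected u w
    exact this _ _ q p.start_mem_support
  have htop : p.toSubgraph = ⊤ := by
    ext a b
    · simp [hsupp]
    · exact ⟨fun h => h.adj_sub, fun h => step a b (hsupp a) h⟩
  have e := hp.pathGraphIsoToSubgraph
  rw [htop] at e
  exact ⟨_, ⟨(e.trans Subgraph.topIso).symm⟩⟩

theorem isPathCover_of_isAcyclic [Finite V] {G P : SimpleGraph V} (hle : P ≤ G)
    (hP : P.IsAcyclic) (hdeg : ∀ v, (P.neighborSet v).ncard ≤ 2) : IsPathCover G P := by
  refine ⟨hle, fun c => exists_iso_pathGraph_of_isTree (hP.isTree_connectedComponent c) ?_⟩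
  intro v
  refine le_trans ?_ (hdeg v)
  exact Set.ncard_le_ncard_of_injOn Subtype.val (fun w hw => hw)
    Subtype.val_injective.injOn (Set.toFinite _)

theorem IsPathNumbering.isPathCover [Finite V] {G P : SimpleGraph V} {r : V → ℕ}
    (h : IsPathNumbering P r) (hle : P ≤ G) : IsPathCover G P :=
  isPathCover_of_isAcyclic hle h.isAcyclic h.ncard_neighborSet_le

/-! ### Degree counting and the upper bound on `Opt`. -/

theorem sum_ncard_neighborSet [Fintype V] (P : SimpleGraph V) :
    ∑ v, (P.neighborSet v).ncard = 2 * numEdges P := by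
  classical
  rw [numEdges, ← coe_edgeFinset, Set.ncard_coe_finset, ← sum_degrees_eq_twice_card_edges]
  refine Finset.sum_congr rfl fun v _ => ?_
  rw [← card_neighborSet_eq_degree, Set.ncard_eq_toFinset_card', Set.toFinset_card]

theorem numEdges_add_one_of_isTree [Finite V] {T : SimpleGraph V} (hT : T.IsTree) :
    numEdges T + 1 = Nat.card V :=
  (isTree_iff_connected_and_card.1 hT).2

theorem ncard_neighborSet_mono [Finite V] {F H : SimpleGraph V} (h : F ≤ H) (v : V) :
    (F.neighborSet v).ncard ≤ (H.neighborSet v).ncard :=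
  Set.ncard_le_ncard (fun _ hw => h hw) (Set.toFinite _)

theorem ncard_neighborSet_lt [Finite V] {F H : SimpleGraph V} (h : F ≤ H) {a b : V}
    (hF : ¬ F.Adj a b) (hH : H.Adj a b) :
    (F.neighborSet a).ncard < (H.neighborSet a).ncard :=
  Set.ncard_lt_ncard ⟨fun _ hw => h hw, fun hsub => hF (hsub hH)⟩ (Set.toFinite _)

/-- Deleting an edge at a vertex of degree above two lowers the total excess by at least one, so the
excess bounds the number of deletions. -/
theorem exists_le_ncard_neighborSet_le_two [Fintype V] (F : SimpleGraph V) :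
    ∃ Q ≤ F, (∀ v, (Q.neighborSet v).ncard ≤ 2) ∧
      numEdges F ≤ numEdges Q + ∑ v, ((F.neighborSet v).ncard - 2) := by
  induction hn : numEdges F using Nat.strong_induction_on generalizing F with
  | _ n ih =>
    by_cases hF : ∀ v, (F.neighborSet v).ncard ≤ 2
    · exact ⟨F, le_rfl, hF, by omega⟩
    push Not at hF
    obtain ⟨a, ha⟩ := hF
    obtain ⟨b, hab⟩ : (F.neighborSet a).Nonempty := by
      rw [← Set.ncard_pos]; omega
    set F' := F.deleteEdges {s(a, b)} with hF'
    have hle : F' ≤ F := deleteEdges_le _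
    have hnadj : ¬ F'.Adj a b := by simp [hF', deleteEdges_adj]
    have hcard : numEdges F' + 1 = numEdges F := by
      rw [numEdges, hF', edgeSet_deleteEdges]
      exact Set.ncard_sdiff_singleton_add_one (show s(a, b) ∈ F.edgeSet from hab) (Set.toFinite _)
    obtain ⟨Q, hQ, hQdeg, hQe⟩ := ih (numEdges F') (by omega) F' rfl
    refine ⟨Q, hQ.trans hle, hQdeg, ?_⟩
    have : ∑ v, ((F'.neighborSet v).ncard - 2) < ∑ v, ((F.neighborSet v).ncard - 2) := by
      refine Finset.sum_lt_sum (fun v _ => ?_) ⟨a, Finset.mem_univ a, ?_⟩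
      · have := ncard_neighborSet_mono hle v
        omega
      · have := ncard_neighborSet_lt hle hnadj hab
        omega
    omega

/-- In a connected graph on at least two vertices, every vertex that is not internal contributes
exactly one to the total deficiency of the degrees from two. -/
theorem sum_two_sub_add_numInternal [Fintype V] [Nontrivial V] {T : SimpleGraph V}
    (hT : T.Connected) :
    ∑ v, (2 - (T.neighborSet v).ncard) + numInternal T = Fintype.card V := by
  classical
  have h1 : numInternal T = ∑ v, if 2 ≤ (T.neighborSet v).ncard then 1 else 0 := by
    rw [numInternal, internalVertices, ← Finset.card_filter, ← Set.ncard_coe_finset]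
    simp
  rw [h1, ← Finset.sum_add_distrib, ← Finset.card_univ, Finset.card_eq_sum_ones]
  refine Finset.sum_congr rfl fun v _ => ?_
  have : 0 < (T.neighborSet v).ncard := by
    rw [Set.ncard_pos]
    obtain ⟨w, hw⟩ := hT.preconnected.exists_adj_of_nontrivial v
    exact ⟨w, hw⟩
  split_ifs <;> omega

theorem IsSpanningTree.numInternal_lt_of_isOptimalPathCover [Finite V] [Nontrivial V]
    {G T P : SimpleGraph V} (hT : IsSpanningTree G T) (hP : IsOptimalPathCover G P) :
    numInternal T + 1 ≤ numEdges P := by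
  cases nonempty_fintype V
  obtain ⟨Q, hQ, hdeg, hQe⟩ := exists_le_ncard_neighborSet_le_two T
  have hPQ := hP.2 Q (isPathCover_of_isAcyclic (hQ.trans hT.1) (hT.2.isAcyclic.anti hQ) hdeg)
  have h1 := sum_two_sub_add_numInternal hT.2.connected
  have h2 := numEdges_add_one_of_isTree hT.2
  have h3 := sum_ncard_neighborSet T
  -- Truncated subtraction: pointwise `(d - 2) + 2 = (2 - d) + d`, so the excess is expressed
  -- through the deficiency.
  have h4 : ∑ v, ((T.neighborSet v).ncard - 2) + 2 * Fintype.card V =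
      ∑ v, (2 - (T.neighborSet v).ncard) + ∑ v, (T.neighborSet v).ncard := by
    rw [← Finset.card_univ, mul_comm, ← smul_eq_mul, ← Finset.sum_const, ← Finset.sum_add_distrib,
      ← Finset.sum_add_distrib]
    exact Finset.sum_congr rfl fun v _ => by omega
  rw [Nat.card_eq_fintype_card] at h2
  omega

/-! ### Joining components to a dominating edge: the lower bound on `Opt`. -/

theorem numEdges_sup_edge [Finite V] {F : SimpleGraph V} {a b : V} (hab : a ≠ b)
    (h : ¬ F.Adj a b) : numEdges (F ⊔ edge a b) = numEdges F + 1 := by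
  rw [numEdges, edgeSet_sup, edgeSet_edge_of_ne hab, Set.union_singleton]
  exact Set.ncard_insert_of_notMem h (Set.toFinite _)

/-- Every component of a finite forest has a vertex of degree at most one. -/
theorem exists_reachable_ncard_neighborSet_le_one [Finite V] {F : SimpleGraph V}
    (hF : F.IsAcyclic) (v : V) : ∃ w, F.Reachable v w ∧ (F.neighborSet w).ncard ≤ 1 := by
  classical
  cases nonempty_fintype V
  set c := F.connectedComponentMk v
  have hT := hF.isTree_connectedComponent c
  have key : ∀ w : c, (F.neighborSet w).ncard ≤ (c.toSimpleGraph.neighborSet w).ncard := by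
    intro w
    have : F.neighborSet w ⊆ Subtype.val '' c.toSimpleGraph.neighborSet w := by
      intro x hx
      refine ⟨⟨x, ?_⟩, hx, rfl⟩
      have hw : F.connectedComponentMk w = c := w.2
      exact (ConnectedComponent.eq.2 ((F.mem_neighborSet _ _).1 hx).symm.reachable).trans hw
    exact (Set.ncard_le_ncard this (Set.toFinite _)).trans (Set.ncard_image_le (Set.toFinite _))
  have reach : ∀ w : c, F.Reachable v w := fun w => (ConnectedComponent.eq.1 w.2).symm
  rcases subsingleton_or_nontrivial c with hs | hn
  · have v' : c := ⟨v, rfl⟩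
    refine ⟨v', reach v', (key v').trans ?_⟩
    exact (Set.ncard_le_one (Set.toFinite _)).2 fun a _ b _ => Subsingleton.elim a b
  · obtain ⟨w, hw⟩ := hT.exists_vert_degree_one_of_nontrivial
    refine ⟨w, reach w, (key w).trans ?_⟩
    rw [← hw, ← card_neighborSet_eq_degree, Set.ncard_eq_toFinset_card', Set.toFinset_card]

/-- A component missing `x` has a vertex `w` of degree at most one. Joining `w` to `x` or `y` adds
one edge and lowers the deficiency at `w` by one, so the sum of the two does not grow; induction is
on the deficiency. -/
theorem exists_isSpanningTree_of_isAcyclic [Fintype V] {G : SimpleGraph V} {x y : V}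
    (hdom : ∀ v, G.Adj v x ∨ G.Adj v y) {F : SimpleGraph V} (hle : F ≤ G) (hF : F.IsAcyclic)
    (hxy : F.Reachable x y) :
    ∃ T, IsSpanningTree G T ∧ ∑ v, (2 - (T.neighborSet v).ncard) + numEdges T ≤
      ∑ v, (2 - (F.neighborSet v).ncard) + numEdges F := by
  induction hn : ∑ v, (2 - (F.neighborSet v).ncard) using Nat.strong_induction_on
    generalizing F with
  | _ n ih =>
    by_cases hconn : ∀ v, F.Reachable x v
    · have : Nonempty V := ⟨x⟩
      exact ⟨F, ⟨hle, ⟨⟨fun u v => (hconn u).symm.trans (hconn v)⟩, hF⟩⟩, hn ▸ le_rfl⟩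
    push Not at hconn
    obtain ⟨v, hv⟩ := hconn
    obtain ⟨w, hvw, hw⟩ := exists_reachable_ncard_neighborSet_le_one hF v
    obtain ⟨z, hxz, hwz⟩ : ∃ z, F.Reachable x z ∧ G.Adj w z := by
      rcases hdom w with h | h
      exacts [⟨x, Reachable.refl x, h⟩, ⟨y, hxy, h⟩]
    have hnr : ¬ F.Reachable w z := fun h => hv (hxz.trans (h.symm.trans hvw.symm))
    have hna : ¬ F.Adj w z := fun h => hnr h.reachable
    have hF' : F ≤ F ⊔ edge w z := le_sup_left
    have hlt : ∑ v, (2 - ((F ⊔ edge w z).neighborSet v).ncard) <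
        ∑ v, (2 - (F.neighborSet v).ncard) := by
      refine Finset.sum_lt_sum (fun v _ => ?_) ⟨w, Finset.mem_univ w, ?_⟩
      · have := ncard_neighborSet_mono hF' v
        omega
      · have := ncard_neighborSet_lt hF' hna (b := z) (by simp [edge_adj, hwz.ne])
        omega
    obtain ⟨T, hT, hTe⟩ := ih _ (hn ▸ hlt) (F := F ⊔ edge w z)
      (sup_le hle ((edge_le_iff _).2 (Or.inr hwz))) (hF.sup_edge_of_not_reachable hnr)
      (hxy.mono hF') rfl
    refine ⟨T, hT, hTe.trans ?_⟩
    rw [numEdges_sup_edge hwz.ne hna]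
    omega

theorem le_opt [Finite V] {G T : SimpleGraph V} (hT : IsSpanningTree G T) :
    numInternal T ≤ Opt G := by
  refine le_csSup ⟨Nat.card V, ?_⟩ ⟨T, hT, rfl⟩
  rintro k ⟨T', -, rfl⟩
  exact Set.ncard_le_card _

theorem two_mul_card_le_of_isAcyclic [Fintype V] [Nontrivial V] {G : SimpleGraph V} {x y : V}
    (hdom : ∀ v, G.Adj v x ∨ G.Adj v y) {F : SimpleGraph V} (hle : F ≤ G) (hF : F.IsAcyclic)
    (hxy : F.Reachable x y) :
    2 * Fintype.card V ≤ Opt G + 1 + (∑ v, (2 - (F.neighborSet v).ncard) + numEdges F) := by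
  obtain ⟨T, hT, hTe⟩ := exists_isSpanningTree_of_isAcyclic hdom hle hF hxy
  have h1 := sum_two_sub_add_numInternal hT.2.connected
  have h2 := numEdges_add_one_of_isTree hT.2
  have h3 := le_opt hT
  rw [Nat.card_eq_fintype_card] at h2
  omega

theorem IsPathCover.isAcyclic {G P : SimpleGraph V} (hP : IsPathCover G P) : P.IsAcyclic := by
  obtain ⟨r, hr⟩ := hP.exists_isPathNumbering
  exact hr.isAcyclic

theorem IsPathCover.ncard_neighborSet_le {G P : SimpleGraph V} (hP : IsPathCover G P) (v : V) :
    (P.neighborSet v).ncard ≤ 2 := by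
  obtain ⟨r, hr⟩ := hP.exists_isPathNumbering
  exact hr.ncard_neighborSet_le v

theorem IsPathCover.sum_two_sub_add [Fintype V] {G P : SimpleGraph V} (hP : IsPathCover G P) :
    ∑ v, (2 - (P.neighborSet v).ncard) + 2 * numEdges P = 2 * Fintype.card V := by
  rw [← sum_ncard_neighborSet, ← Finset.sum_add_distrib, mul_comm, ← smul_eq_mul,
    ← Finset.card_univ, ← Finset.sum_const]
  refine Finset.sum_congr rfl fun v _ => ?_
  have := hP.ncard_neighborSet_le v
  omega

theorem IsPathCover.numEdges_le_opt_add_one [Finite V] [Nontrivial V] {G P : SimpleGraph V}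
    (hP : IsPathCover G P) {x y : V} (hdom : ∀ v, G.Adj v x ∨ G.Adj v y)
    (hxy : P.Reachable x y) : numEdges P ≤ Opt G + 1 := by
  cases nonempty_fintype V
  have h1 := two_mul_card_le_of_isAcyclic hdom hP.1 hP.isAcyclic hxy
  have h2 := hP.sum_two_sub_add
  omega

theorem IsPathCover.numEdges_le_opt_add_two [Finite V] [Nontrivial V] {G P : SimpleGraph V}
    (hP : IsPathCover G P) {x y : V} (hdom : ∀ v, G.Adj v x ∨ G.Adj v y)
    (hxy : G.Adj x y) : numEdges P ≤ Opt G + 2 := by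
  cases nonempty_fintype V
  by_cases hr : P.Reachable x y
  · have := hP.numEdges_le_opt_add_one hdom hr
    omega
  have hna : ¬ P.Adj x y := fun h => hr h.reachable
  have h1 := two_mul_card_le_of_isAcyclic hdom
    (sup_le hP.1 ((edge_le_iff _).2 (Or.inr hxy))) (hP.isAcyclic.sup_edge_of_not_reachable hr)
    (SimpleGraph.Adj.reachable (by simp [edge_adj, hxy.ne]))
  have h2 := hP.sum_two_sub_add
  have h3 : ∑ v, (2 - ((P ⊔ edge x y).neighborSet v).ncard) ≤
      ∑ v, (2 - (P.neighborSet v).ncard) :=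
    Finset.sum_le_sum fun v _ => by
      have := ncard_neighborSet_mono (le_sup_left : P ≤ P ⊔ edge x y) v
      omega
  rw [numEdges_sup_edge hxy.ne hna] at h1
  omega

/-- Take `x` with the largest neighborhood in `X` and `y` a neighbor of the vertex with the
smallest: `y` sees all of `X`, and `x` sees all of `Y` as no vertex is isolated. -/
theorem IsChainGraph.exists_adj_dominating [Nontrivial V] {G : SimpleGraph V}
    (hG : IsChainGraph G) (hconn : G.Connected) :
    ∃ x y, G.Adj x y ∧ ∀ v, G.Adj v x ∨ G.Adj v y := by
  obtain ⟨X, Y, hb, hXY, m, f, -, rfl, hmono⟩ := hG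
  have hnbr := hconn.preconnected.exists_adj_of_nontrivial
  have hcases : ∀ v, v ∈ Set.range f ∨ v ∈ Y := fun v => by
    have := Set.mem_univ v
    rwa [← hXY] at this
  have hm : 0 < m := by
    obtain ⟨v⟩ := hconn.nonempty
    obtain ⟨w, hw⟩ := hnbr v
    rcases hcases v with ⟨i, -⟩ | hv
    · exact i.pos
    · obtain ⟨i, -⟩ := hb.symm.mem_of_mem_adj hv hw
      exact i.pos
  have hlast : ∀ i w, G.Adj (f i) w → G.Adj (f ⟨m - 1, by omega⟩) w := fun i w h =>
    hmono (show i ≤ ⟨m - 1, by omega⟩ from Fin.le_def.2 (by simp; omega)) h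
  obtain ⟨y, hy⟩ := hnbr (f ⟨0, hm⟩)
  have hfirst : ∀ i, G.Adj (f i) y := fun i =>
    hmono (show ⟨0, hm⟩ ≤ i from Fin.le_def.2 (by simp)) hy
  refine ⟨f ⟨m - 1, by omega⟩, y, hfirst _, fun v => ?_⟩
  rcases hcases v with ⟨i, rfl⟩ | hv
  · exact Or.inr (hfirst i)
  · obtain ⟨w, hw⟩ := hnbr v
    obtain ⟨i, rfl⟩ := hb.symm.mem_of_mem_adj hv hw
    exact Or.inl (hlast i v hw.symm).symm

theorem IsOptimalPathCover.opt_add_one_le [Finite V] [Nontrivial V] {G P : SimpleGraph V}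
    (hG : G.Connected) (hP : IsOptimalPathCover G P) : Opt G + 1 ≤ numEdges P := by
  obtain ⟨T, hT⟩ := exists_isMIST hG
  rw [← hT.numInternal_eq_opt]
  exact hT.1.numInternal_lt_of_isOptimalPathCover hP

theorem IsOptimalPathCover.opt_eq [Finite V] [Nontrivial V] {G P : SimpleGraph V}
    (hG : G.Connected) (hchain : IsChainGraph G) (hP : IsOptimalPathCover G P) :
    (Opt G : ℤ) = (numEdges P : ℤ) - 1 ∨ (Opt G : ℤ) = (numEdges P : ℤ) - 2 := by
  obtain ⟨x, y, hxy, hdom⟩ := hchain.exists_adj_dominating hG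
  have h1 := hP.opt_add_one_le hG
  have h2 := hP.1.numEdges_le_opt_add_two hdom hxy
  omega

/-! ### The two examples. -/

/-- The bipartite graph in which the `i`-th vertex on the left is adjacent to the first `f i`
vertices on the right. -/
def staircase {m n : ℕ} (f : Fin m → ℕ) : SimpleGraph (Fin m ⊕ Fin n) where
  Adj
    | .inl i, .inr j => j.val < f i
    | .inr j, .inl i => j.val < f i
    | _, _ => False
  symm := ⟨by rintro (i | i) (j | j) h <;> exact h⟩
  loopless := ⟨by rintro (i | i) h <;> exact h⟩

instance {m n : ℕ} (f : Fin m → ℕ) : DecidableRel (staircase (n := n) f).Adj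
  | .inl i, .inr j => inferInstanceAs (Decidable (j.val < f i))
  | .inr j, .inl i => inferInstanceAs (Decidable (j.val < f i))
  | .inl _, .inl _ => inferInstanceAs (Decidable False)
  | .inr _, .inr _ => inferInstanceAs (Decidable False)

theorem isChainGraphWith_staircase {m n : ℕ} {f : Fin m → ℕ} (hf : Monotone f) :
    IsChainGraphWith (staircase (n := n) f) (Set.range Sum.inl) (Set.range Sum.inr) where
  isBipartiteWith :=
    { disjoint := Set.isCompl_range_inl_range_inr.disjoint
      mem_of_adj := by
        rintro (i | i) (j | j) h
        · exact h.elim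
        · exact Or.inl ⟨⟨i, rfl⟩, ⟨j, rfl⟩⟩
        · exact Or.inr ⟨⟨i, rfl⟩, ⟨j, rfl⟩⟩
        · exact h.elim }
  union_eq := Set.range_inl_union_range_inr
  chain := by
    refine ⟨m, Sum.inl, Sum.inl_injective, rfl, ?_⟩
    rintro i i' hi (j | j) h
    · exact h
    · exact lt_of_lt_of_le h (hf hi)

/-- Two vertices are adjacent when their numbers are consecutive. -/
def consecutiveGraph (r : V → ℕ) : SimpleGraph V where
  Adj u v := r v = r u + 1 ∨ r u = r v + 1
  symm := ⟨fun _ _ h => h.symm⟩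
  loopless := ⟨fun _ h => by omega⟩

instance (r : V → ℕ) : DecidableRel (consecutiveGraph r).Adj :=
  fun u v => inferInstanceAs (Decidable (r v = r u + 1 ∨ r u = r v + 1))

theorem isPathCover_inf_consecutiveGraph [Finite V] (G : SimpleGraph V) {r : V → ℕ}
    (hr : Function.Injective r) : IsPathCover G (G ⊓ consecutiveGraph r) :=
  IsPathNumbering.isPathCover (r := r) ⟨fun _ _ h => h.2, fun _ _ _ h => hr h⟩ inf_le_left

theorem connected_of_dominating {G : SimpleGraph V} {x y : V} (hxy : G.Adj x y)
    (hdom : ∀ v, G.Adj v x ∨ G.Adj v y) : G.Connected := by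
  have h : ∀ v, G.Reachable v x := fun v =>
    (hdom v).elim (fun h => h.reachable) fun h => h.reachable.trans hxy.symm.reachable
  have : Nonempty V := ⟨x⟩
  exact ⟨fun u v => (h u).trans (h v).symm⟩

/-- Each edge is incident to `S`. For a path cover this gives at most two edges per vertex of a
vertex cover, which certifies optimality in the examples. -/
theorem numEdges_le_sum_of_cover [Finite V] (P : SimpleGraph V) (S : Finset V)
    (hS : ∀ u v, P.Adj u v → u ∈ S ∨ v ∈ S) :
    numEdges P ≤ ∑ v ∈ S, (P.neighborSet v).ncard := by
  classical
  cases nonempty_fintype V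
  have hsub : P.edgeFinset ⊆ S.biUnion fun v => P.incidenceFinset v := by
    intro e
    induction e with
    | _ u v =>
      intro he
      rw [mem_edgeFinset, mem_edgeSet] at he
      rw [Finset.mem_biUnion]
      rcases hS u v he with h | h
      · exact ⟨u, h, by simp [he]⟩
      · exact ⟨v, h, by simp [mk'_mem_incidenceSet_iff, he]⟩
  rw [numEdges, ← coe_edgeFinset, Set.ncard_coe_finset]
  refine (Finset.card_le_card hsub).trans (Finset.card_biUnion_le.trans (Finset.sum_le_sum ?_))
  intro v _
  rw [card_incidenceFinset_eq_degree, ← card_neighborSet_eq_degree,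
    Set.ncard_eq_toFinset_card', Set.toFinset_card]

theorem not_isAcyclic_of_four_cycle {T : SimpleGraph V} {a b c d : V} (hab : a ≠ b) (hcd : c ≠ d)
    (hac : T.Adj a c) (had : T.Adj a d) (hbc : T.Adj b c) (hbd : T.Adj b d) :
    ¬ T.IsAcyclic := by
  intro hT
  have h := (hT.subsingleton_path a b).elim
    ⟨Walk.cons hac (Walk.cons hbc.symm Walk.nil), by simp [hab, hac.ne, hbc.ne.symm]⟩
    ⟨Walk.cons had (Walk.cons hbd.symm Walk.nil), by simp [hab, had.ne, hbd.ne.symm]⟩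
  have h' := congrArg (fun p => p.1.support) h
  simp [hcd] at h'

/-- Of two vertices with the same two possible neighbors, one is not internal in a tree. -/
theorem IsSpanningTree.not_internal_or_not_internal [Finite V] {G T : SimpleGraph V}
    (hT : IsSpanningTree G T) {a b c d : V} (hab : a ≠ b) (hcd : c ≠ d)
    (ha : ∀ w, G.Adj a w → w = c ∨ w = d) (hb : ∀ w, G.Adj b w → w = c ∨ w = d) :
    a ∉ internalVertices T ∨ b ∉ internalVertices T := by
  by_contra! h
  have key : ∀ v, (∀ w, G.Adj v w → w = c ∨ w = d) → v ∈ internalVertices T →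
      T.neighborSet v = {c, d} := fun v hv hint =>
    Set.eq_of_subset_of_ncard_le (fun w hw => hv w (hT.1 hw))
      (by rw [Set.ncard_pair hcd]; exact hint) (Set.toFinite _)
  have ha' := key a ha h.1
  have hb' := key b hb h.2
  refine not_isAcyclic_of_four_cycle (T := T) hab hcd ?_ ?_ ?_ ?_ hT.2.isAcyclic <;>
    rw [← mem_neighborSet] <;> simp [ha', hb']

theorem ncard_neighborSet_le_one_of_forall_eq {G : SimpleGraph V} {a c : V}
    (ha : ∀ w, G.Adj a w → w = c) : (G.neighborSet a).ncard ≤ 1 := by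
  rw [← Set.ncard_singleton c]
  exact Set.ncard_le_ncard ha (Set.finite_singleton c)

theorem IsSpanningTree.not_internal_of_forall_eq {G T : SimpleGraph V}
    (hT : IsSpanningTree G T) {a c : V} (ha : ∀ w, G.Adj a w → w = c) :
    a ∉ internalVertices T := by
  intro h
  have := ncard_neighborSet_le_one_of_forall_eq (G := T) fun w hw => ha w (hT.1 hw)
  have h2 : 2 ≤ (T.neighborSet a).ncard := h
  omega

theorem numInternal_add_card_le [Fintype V] {T : SimpleGraph V} (L : Finset V)
    (hL : ∀ v ∈ L, v ∉ internalVertices T) : numInternal T + L.card ≤ Fintype.card V := by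
  rw [numInternal, ← Set.ncard_coe_finset L, ← Nat.card_eq_fintype_card, ← Set.ncard_univ,
    ← Set.ncard_union_eq (Set.disjoint_left.2 fun v hv hvL => hL v hvL hv)]
  exact Set.ncard_le_ncard (Set.subset_univ _)

theorem isPendant_iff_degree [Fintype V] (G : SimpleGraph V) [DecidableRel G.Adj] (v : V) :
    IsPendant G v ↔ G.degree v = 1 := by
  rw [IsPendant, Set.ncard_eq_toFinset_card', Set.toFinset_card, card_neighborSet_eq_degree]

theorem numEdges_eq_card_edgeFinset [Fintype V] [DecidableEq V] (G : SimpleGraph V)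
    [DecidableRel G.Adj] : numEdges G = G.edgeFinset.card := by
  rw [numEdges, ← coe_edgeFinset, Set.ncard_coe_finset]

theorem exists_chain_graph_opt_eq_sub_two : ∃ G : SimpleGraph (Fin 5 ⊕ Fin 5),
    G.Connected ∧ IsChainGraphWith G (Set.range Sum.inl) (Set.range Sum.inr) ∧
      AtMostOnePendantNeighbor G ∧ ∃ P : SimpleGraph (Fin 5 ⊕ Fin 5),
        IsOptimalPathCover G P ∧ numEdges P = 8 ∧ Opt G = 6 := by
  have : Nontrivial (Fin 5 ⊕ Fin 5) := ⟨.inl 0, .inr 0, by simp⟩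
  set G : SimpleGraph (Fin 5 ⊕ Fin 5) := staircase ![1, 2, 2, 4, 5] with hGdef
  -- The vertices numbered 4 and 5 are not adjacent, so this gives two paths on five vertices each.
  set r : Fin 5 ⊕ Fin 5 → ℕ := Sum.elim ![0, 2, 4, 8, 6] ![1, 3, 9, 7, 5] with hrdef
  have hconn : G.Connected :=
    connected_of_dominating (x := .inl 4) (y := .inr 0) (by decide) (by decide)
  have hchain := isChainGraphWith_staircase (n := 5) (f := ![1, 2, 2, 4, 5]) (by decide)
  have hP : IsPathCover G (G ⊓ consecutiveGraph r) :=
    isPathCover_inf_consecutiveGraph G (by decide)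
  have hcard : numEdges (G ⊓ consecutiveGraph r) = 8 := by
    rw [numEdges_eq_card_edgeFinset]
    decide +kernel
  have hopt : IsOptimalPathCover G (G ⊓ consecutiveGraph r) := by
    refine ⟨hP, fun Q hQ => ?_⟩
    have hS : ∀ u v, G.Adj u v → u ∈ ({.inr 0, .inr 1, .inl 3, .inl 4} : Finset _) ∨
      v ∈ ({.inr 0, .inr 1, .inl 3, .inl 4} : Finset _) := by decide
    have h1 := numEdges_le_sum_of_cover Q _ fun u v h => hS u v (hQ.1 h)
    have h2 := Finset.sum_le_card_nsmul ({.inr 0, .inr 1, .inl 3, .inl 4} : Finset _)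
      (fun v => (Q.neighborSet v).ncard) 2 fun v _ => hQ.ncard_neighborSet_le v
    rw [hcard]
    exact h1.trans h2
  refine ⟨G, hconn, hchain, ?_, _, hopt, hcard, ?_⟩
  · intro u a b
    simp only [isPendant_iff_degree]
    revert u a b
    decide +kernel
  · have h1 := hopt.opt_eq hconn ⟨_, _, hchain⟩
    obtain ⟨T, hT⟩ := exists_isMIST hconn
    have h2 : numInternal T ≤ 6 := by
      have hl := hT.1.not_internal_of_forall_eq (a := .inl 0) (c := .inr 0) (by decide)
      have hr := hT.1.not_internal_of_forall_eq (a := .inr 4) (c := .inl 4) (by decide)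
      -- Four forced leaves among ten vertices: the two pendant ones and one from each of two pairs
      -- of twins with two common neighbors.
      have key : ∀ u w, u ∉ internalVertices T → w ∉ internalVertices T →
          ({.inl 0, .inr 4, u, w} : Finset (Fin 5 ⊕ Fin 5)).card = 4 → numInternal T ≤ 6 := by
        intro u w hu hw hc
        have := numInternal_add_card_le (T := T) {.inl 0, .inr 4, u, w} (by simp [hl, hr, hu, hw])
        rw [hc] at this
        simp at this
        omega
      rcases hT.1.not_internal_or_not_internal (a := .inl 1) (b := .inl 2) (c := .inr 0)
          (d := .inr 1) (by decide) (by decide) (by decide) (by decide) with hu | hu <;>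
        rcases hT.1.not_internal_or_not_internal (a := .inr 2) (b := .inr 3) (c := .inl 3)
          (d := .inl 4) (by decide) (by decide) (by decide) (by decide) with hw | hw <;>
        exact key _ _ hu hw (by decide)
    rw [hT.numInternal_eq_opt] at h2
    -- The dichotomy supplies `Opt G ≥ 8 - 2`.
    omega

theorem exists_chain_graph_opt_eq_sub_one : ∃ G : SimpleGraph (Fin 6 ⊕ Fin 5),
    G.Connected ∧ IsChainGraphWith G (Set.range Sum.inl) (Set.range Sum.inr) ∧
      AtMostOnePendantNeighbor G ∧ ∃ P : SimpleGraph (Fin 6 ⊕ Fin 5),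
        IsOptimalPathCover G P ∧ numEdges P = 9 ∧ Opt G = 8 := by
  have : Nontrivial (Fin 6 ⊕ Fin 5) := ⟨.inl 0, .inr 0, by simp⟩
  set G : SimpleGraph (Fin 6 ⊕ Fin 5) := staircase ![4, 4, 4, 4, 4, 5] with hGdef
  -- A path on ten vertices; `.inl 4`, numbered 10, stays isolated because it is not adjacent to
  -- `.inr 4`.
  set r : Fin 6 ⊕ Fin 5 → ℕ := Sum.elim ![0, 2, 4, 6, 10, 8] ![1, 3, 5, 7, 9] with hrdef
  have hdom : ∀ v, G.Adj v (.inl 5) ∨ G.Adj v (.inr 0) := by decide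
  have hconn : G.Connected := connected_of_dominating (by decide) hdom
  have hchain := isChainGraphWith_staircase (n := 5) (f := ![4, 4, 4, 4, 4, 5]) (by decide)
  have hP : IsPathCover G (G ⊓ consecutiveGraph r) :=
    isPathCover_inf_consecutiveGraph G (by decide)
  have hcard : numEdges (G ⊓ consecutiveGraph r) = 9 := by
    rw [numEdges_eq_card_edgeFinset]
    decide +kernel
  have hopt : IsOptimalPathCover G (G ⊓ consecutiveGraph r) := by
    refine ⟨hP, fun Q hQ => ?_⟩
    -- The right side covers all edges; four of its vertices contribute at most 2 and the pendant
    -- `.inr 4` at most 1, in total 9.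
    have hS : ∀ u v, G.Adj u v → u ∈ Finset.univ.map (.inr : Fin 5 ↪ Fin 6 ⊕ Fin 5) ∨
      v ∈ Finset.univ.map (.inr : Fin 5 ↪ Fin 6 ⊕ Fin 5) := by decide
    have h1 := numEdges_le_sum_of_cover Q _ fun u v h => hS u v (hQ.1 h)
    have h2 := fun v => hQ.ncard_neighborSet_le v
    have hpend : ∀ w, G.Adj (.inr 4) w → w = .inl 5 := by decide
    have h3 := ncard_neighborSet_le_one_of_forall_eq fun w hw => hpend w (hQ.1 hw)
    rw [Finset.sum_map, Fin.sum_univ_five] at h1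
    have h4 := h2 (.inr 0)
    have h5 := h2 (.inr 1)
    have h6 := h2 (.inr 2)
    have h7 := h2 (.inr 3)
    simp only [Function.Embedding.inr_apply] at h1
    omega
  refine ⟨G, hconn, hchain, ?_, _, hopt, hcard, ?_⟩
  · have hpend : ∀ v, G.degree v = 1 → v = .inr 4 := by decide +kernel
    intro u a b _ _ ha hb
    rw [hpend a ((isPendant_iff_degree G a).1 ha), hpend b ((isPendant_iff_degree G b).1 hb)]
  · have hadj : ∀ u v, (G ⊓ consecutiveGraph r).Adj u v →
        (G ⊓ consecutiveGraph r).Reachable u v := fun u v h => h.reachable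
    -- Both ends of the dominating edge lie on the long path, so the sharper bound `|E| - 1`
    -- applies.
    have hreach : (G ⊓ consecutiveGraph r).Reachable (.inl 5) (.inr 0) :=
      (hadj _ (.inr 3) (by decide)).trans <| (hadj _ (.inl 3) (by decide)).trans <|
      (hadj _ (.inr 2) (by decide)).trans <| (hadj _ (.inl 2) (by decide)).trans <|
      (hadj _ (.inr 1) (by decide)).trans <| (hadj _ (.inl 1) (by decide)).trans <|
      hadj _ _ (by decide)
    have h1 := hopt.opt_add_one_le hconn
    have h2 := hP.numEdges_le_opt_add_one hdom hreach
    omega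

end ChainMIST

theorem mainTheorem5 :
    -- the dichotomy, for every finite connected chain graph with at least two vertices
    (∀ {V : Type*} [Finite V] [Nontrivial V] (G : SimpleGraph V),
      G.Connected → ChainMIST.IsChainGraph G →
      ∀ P : SimpleGraph V, ChainMIST.IsOptimalPathCover G P →
        (ChainMIST.Opt G : ℤ) = (ChainMIST.numEdges P : ℤ) - 1 ∨
        (ChainMIST.Opt G : ℤ) = (ChainMIST.numEdges P : ℤ) - 2) ∧
    -- the value `|E(P)| - 2` occurs: a chain graph with parts of sizes 5 and 5
    (∃ G₁ : SimpleGraph (Fin 5 ⊕ Fin 5),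
      G₁.Connected ∧
      ChainMIST.IsChainGraphWith G₁ (Set.range Sum.inl) (Set.range Sum.inr) ∧
      ChainMIST.AtMostOnePendantNeighbor G₁ ∧
      ∃ P : SimpleGraph (Fin 5 ⊕ Fin 5), ChainMIST.IsOptimalPathCover G₁ P ∧
        ChainMIST.numEdges P = 8 ∧ ChainMIST.Opt G₁ = 6) ∧
    -- the value `|E(P)| - 1` occurs: a chain graph with parts of sizes 6 and 5
    (∃ G₂ : SimpleGraph (Fin 6 ⊕ Fin 5),
      G₂.Connected ∧
      ChainMIST.IsChainGraphWith G₂ (Set.range Sum.inl) (Set.range Sum.inr) ∧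
      ChainMIST.AtMostOnePendantNeighbor G₂ ∧
      ∃ P : SimpleGraph (Fin 6 ⊕ Fin 5), ChainMIST.IsOptimalPathCover G₂ P ∧
        ChainMIST.numEdges P = 9 ∧ ChainMIST.Opt G₂ = 8) := by
  refine ⟨?_, ChainMIST.exists_chain_graph_opt_eq_sub_two,
    ChainMIST.exists_chain_graph_opt_eq_sub_one⟩
  intro V _ _ G hG hchain P hP
  exact hP.opt_eq hG hchain
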